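/- Let $h>0$ and let $g:[0,\infty)\to[0,\infty)$ be Lipschitz continuous with constant $L_g$ and have exactly two fixed points, $0$ and $\kappa>0$ (hence $L_g>1$). For $c,\lambda\in\mathbb R$ put $E_c(\lambda)=-\lambda^2+c\lambda+1-L_ge^{-\lambda ch}$ and let $c(L_g)=\inf\{c>0: E_c(\lambda)\ge 0 \text{ for some }\lambda\in\mathbb R\}$. Fix $c\ge c(L_g)$, let $\lambda_1(c)\le\lambda_2(c)$ be the two solutions (which may coincide) of $E_c(\lambda)=0$, fix $\lambda_c\in[\lambda_1(c),\lambda_2(c)]$, and for $b\in\mathbb R$ put $\eta_b(z)=\min\{1,e^{\lambda_c(z-b)}\}$. For $I\subset\mathbb R$ let $L(I)=\sup\{|g(x)-g(y)|/|x-y| : x,y\in I\cap[0,\infty),\ x\ne y\}$. Let $v,\psi:[-h,\infty)\times\mathbb R\to[0,\infty)$ be two classical solutions of $$v_t(t,z)=v_{zz}(t,z)-cv_z(t,z)-v(t,z)+g(v(t-h,z-ch)),\qquad t>0,\ z\in\mathbb R,$$ that is, continuous functions on $[-h,\infty)\times\mathbb R$ for which the derivatives $v_t,v_z,v_{zz}$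 exist and the equation holds at every point with $t>0$, and which for every $T$ are bounded by $Ae^{az^2}$ on $[-h,T]\times\mathbb R$ with some constants $A,a$ depending on $T$. Suppose that there are $M,b\in\mathbb R$ and $l_0>0$ with $$\psi(t,z)\in[M-l_0,M+l_0]\quad\text{for all }(t,z)\in[-h,\infty)\times[b-ch,\infty),$$ that for some $l_1>l_0$ $$|v(s,z)-\psi(s,z)|<(l_1-l_0)\,\eta_b(z)\quad\text{for all }(s,z)\in[-h,0]\times\mathbb R,$$ and that $L(I_1)<1$, where $I_1=[M-l_1,M+l_1]$. Then there exists $\gamma_0\ge 0$ satisfying $$-\lambda_c^2+c\lambda_c+1\ \ge\ \gamma_0+L_ge^{\gamma_0h}e^{-\lambda_cch}\quad\text{and}\quad L(I_1)\le e^{-\gamma_0h}(1-\gamma_0)$$ such that $$|v(t,z)-\psi(t,z)|\le(l_1-l_0)e^{-\gamma_0t}\eta_b(z)\quad\text{for all }(t,z)\in[-h,\infty)\times\mathbb R.$$ -/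

import Mathlib

open Set

noncomputable section

namespace DelayedRD

/-- `g`, restricted to `[0, ∞)`, is a birth function: it maps `[0, ∞)` into itself, is Lipschitz
there with constant `L`, and its only fixed points there are `0` and `κ > 0`.
The values of `g` at negative arguments play no role anywhere. -/
structure IsBirthFunction (g : ℝ → ℝ) (L : NNReal) (κ : ℝ) : Prop where
  mapsTo : MapsTo g (Ici 0) (Ici 0)
  lipschitz : LipschitzOnWith L g (Ici 0)
  pos : 0 < κ
  fixed : ∀ x, 0 ≤ x → (g x = x ↔ x = 0 ∨ x = κ)

/-- The best Lipschitz constant of `g` on `I ∩ [0, ∞)`, the part of `I` in the domain of `g`: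
the supremum of `|g x - g y| / |x - y|` over distinct `x, y`. (The set is bounded above for
a birth function `g`.) -/
def lipConst (g : ℝ → ℝ) (I : Set ℝ) : ℝ :=
  sSup {r : ℝ | ∃ x ∈ I ∩ Ici 0, ∃ y ∈ I ∩ Ici 0, x ≠ y ∧ r = |g x - g y| / |x - y|}

/-- The characteristic function `E_c(l) = -l² + c l + 1 - L e^{-l c h}`. -/
def charFun (L h c l : ℝ) : ℝ :=
  -l ^ 2 + c * l + 1 - L * Real.exp (-l * c * h)

/-- The speed `c(L) = inf {c > 0 : E_c(l) ≥ 0 for some real l}`. -/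
def criticalSpeed (L h : ℝ) : ℝ :=
  sInf {c : ℝ | 0 < c ∧ ∃ l : ℝ, 0 ≤ charFun L h c l}

/-- The weight `η_b(z) = min {1, e^{l (z - b)}}`. -/
def weight (l b z : ℝ) : ℝ :=
  min 1 (Real.exp (l * (z - b)))

/-- `v` (as a function of `t ≥ -h` and `z`) is a nonnegative classical solution of
`v_t(t,z) = v_zz(t,z) - c v_z(t,z) - v(t,z) + g(v(t-h, z-ch))`, `t > 0`, `z ∈ ℝ`.
Its initial datum is its restriction to `[-h, 0] × ℝ`. The values lie in the domain `[0, ∞)` of `g`,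
and the growth is at most Gaussian on bounded time intervals, which is the usual class of
solutions of a parabolic Cauchy problem on the line (the Phragmen-Lindelof class).
Continuity of the derivatives is not demanded. -/
structure IsSolution (g : ℝ → ℝ) (h c : ℝ) (v : ℝ → ℝ → ℝ) : Prop where
  continuousOn : ContinuousOn (fun p : ℝ × ℝ => v p.1 p.2) (Ici (-h) ×ˢ univ)
  nonneg : ∀ t, -h ≤ t → ∀ z, 0 ≤ v t z
  growth : ∀ T : ℝ, ∃ A a : ℝ, ∀ t ∈ Icc (-h) T, ∀ z, v t z ≤ A * Real.exp (a * z ^ 2)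
  differentiable_time : ∀ t, 0 < t → ∀ z, DifferentiableAt ℝ (fun s => v s z) t
  differentiable_space : ∀ t, 0 < t → Differentiable ℝ (v t)
  differentiable_space_deriv : ∀ t, 0 < t → Differentiable ℝ (deriv (v t))
  equation : ∀ t, 0 < t → ∀ z,
    deriv (fun s => v s z) t =
      deriv (deriv (v t)) z - c * deriv (v t) z - v t z + g (v (t - h) (z - c * h))

end DelayedRD

end

/-!
The difference `w = v - ψ` solves the linear equation `w_t = w_zz - c w_z - w + f` with source
`f(t, z) = g(v(t-h, z-ch)) - g(ψ(t-h, z-ch))`, and it is dominated by two smooth supersolutions: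

* `K e^{-γt} e^{lam (z-b)}` on the whole line, since `|f| ≤ Lg |w(t-h, z-ch)|` and the first
  inequality for `γ` is exactly the supersolution inequality for this exponential;
* `K e^{-γt}`. To the left of `b` this is larger than the exponential one, so nothing is left to
  prove there. To the right of `b`, both `v` and `ψ` take values in `[M - l1, M + l1]` at
  `(t-h, z-ch)`, and the second inequality for `γ` is the supersolution inequality.

Using the two barriers separately avoids the kink of their minimum. Since the source at time `t`
only involves time `t - h`, the bound is propagated over successive time intervals of length `h`
(`abs_sub_le_of_admissible`).

The comparison is the maximum principle in the Phragmen-Lindelof class,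
`nonpos_of_subsolution`: a function of at most Gaussian growth which is a subsolution wherever it is
positive, and which is nonpositive initially, stays nonpositive. On a short time interval one
subtracts `ε exp (p(t) (z² + 1))` with `p` increasing so fast that this is a supersolution, and
the difference attains its supremum, where the derivative tests give a contradiction.

The admissible rates `γ` form a compact set. It contains `0`, by concavity of the characteristic
function and `lipConst < 1`, and its largest element serves as `γ₀`; this is positive as soon as
`E_c(lamc) > 0`.
-/

namespace DelayedRD

open Filter Topology

/-! ### Derivative tests at a maximum -/

lemma second_deriv_nonpos_of_max {f f' : ℝ → ℝ} {f'' x : ℝ}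
    (hf : ∀ z, HasDerivAt f (f' z) z) (hf' : HasDerivAt f' f'' x)
    (hmax : ∀ z, f z ≤ f x) : f'' ≤ 0 := by
  by_contra hpos
  push Not at hpos
  have hd : deriv f = f' := funext fun z => (hf z).deriv
  have hloc : IsLocalMax f x := Eventually.of_forall hmax
  have hmin : IsLocalMin f x := by
    apply isLocalMin_of_deriv_deriv_pos
    · rw [hd, hf'.deriv]; exact hpos
    · exact hloc.deriv_eq_zero
    · exact (hf x).continuousAt
  -- A point that is both a local minimum and a maximum makes `f` locally constant.
  have hconst : f =ᶠ[𝓝 x] fun _ => f x := by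
    filter_upwards [hmin] with z hz using le_antisymm (hmax z) hz
  have h2 : deriv (deriv f) x = 0 := by
    rw [hconst.deriv.deriv_eq]; simp
  rw [hd, hf'.deriv] at h2
  exact hpos.ne' h2

lemma deriv_nonneg_of_left_max {f : ℝ → ℝ} {p t₀ t : ℝ} (ht : t₀ < t)
    (hf : HasDerivAt f p t) (hmax : ∀ s ∈ Icc t₀ t, f s ≤ f t) : 0 ≤ p := by
  have h1 : Tendsto (slope f t) (𝓝[<] t) (𝓝 p) :=
    (hasDerivWithinAt_iff_tendsto_slope' (by simp)).1 (hf.hasDerivWithinAt (s := Iio t))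
  refine ge_of_tendsto h1 ?_
  filter_upwards [Ioo_mem_nhdsLT ht] with s hs
  rw [slope_def_field]
  exact div_nonneg_of_nonpos (by linarith [hmax s ⟨hs.1.le, hs.2.le⟩]) (by linarith [hs.2])

/-! ### The maximum principle in the class of Gaussian growth -/

/-- `exp ((q + m (t - t₀)) (z² + 1))` is a supersolution as long as `q + m (t - t₀) ≤ 2 q`, if `m`
is large enough. -/
lemma gaussian_supersolution {q m c p z : ℝ} (hq : 0 < q)
    (hm : m = 16 * q ^ 2 + 4 * q + 2 * |c| * q) (hp : q ≤ p) (hp2 : p ≤ 2 * q) :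
    (2 * p + 4 * p ^ 2 * z ^ 2) - c * (2 * p * z) - 1 ≤ m * (z ^ 2 + 1) := by
  have hp0 : 0 < p := by linarith
  have h1 : -(c * (2 * p * z)) ≤ |c| * p * (z ^ 2 + 1) := by
    have : -(c * z) ≤ |c| * |z| := by rw [← abs_mul]; exact neg_le_abs _
    have h2 : 2 * |z| ≤ z ^ 2 + 1 := by nlinarith [sq_nonneg (|z| - 1), sq_abs z]
    calc -(c * (2 * p * z)) = 2 * p * (-(c * z)) := by ring
      _ ≤ 2 * p * (|c| * |z|) := by gcongr
      _ = |c| * p * (2 * |z|) := by ring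
      _ ≤ _ := by gcongr
  have h3 : |c| * p * (z ^ 2 + 1) ≤ |c| * (2 * q) * (z ^ 2 + 1) := by gcongr
  have h4 : 4 * p ^ 2 * z ^ 2 ≤ 4 * (2 * q) ^ 2 * z ^ 2 := by gcongr
  rw [hm]
  nlinarith [sq_nonneg z, sq_nonneg q, mul_nonneg hq.le (sq_nonneg z)]

/-- The maximum principle on a time interval so short that a Gaussian barrier exists on it. -/
lemma nonpos_of_subsolution_short {u ut uz uzz : ℝ → ℝ → ℝ} {c A a t₀ t₁ q m : ℝ}
    (ha : 0 ≤ a) (hA : 0 ≤ A) (hq : q = a + 1)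
    (hm : m = 16 * q ^ 2 + 4 * q + 2 * |c| * q) (hlen : m * (t₁ - t₀) ≤ q)
    (hcont : ContinuousOn (fun p : ℝ × ℝ => u p.1 p.2) (Icc t₀ t₁ ×ˢ univ))
    (hgrowth : ∀ t ∈ Icc t₀ t₁, ∀ z, u t z ≤ A * Real.exp (a * z ^ 2))
    (hinit : ∀ z, u t₀ z ≤ 0)
    (hut : ∀ t ∈ Ioc t₀ t₁, ∀ z, HasDerivAt (fun s => u s z) (ut t z) t)
    (huz : ∀ t ∈ Ioc t₀ t₁, ∀ z, HasDerivAt (u t) (uz t z) z)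
    (huzz : ∀ t ∈ Ioc t₀ t₁, ∀ z, HasDerivAt (uz t) (uzz t z) z)
    (hsub : ∀ t ∈ Ioc t₀ t₁, ∀ z, 0 < u t z → ut t z ≤ uzz t z - c * uz t z - u t z) :
    ∀ t ∈ Icc t₀ t₁, ∀ z, u t z ≤ 0 := by
  have hq0 : 0 < q := by linarith
  have hm0 : 0 < m := by rw [hm]; positivity
  set φ : ℝ → ℝ → ℝ := fun t z => Real.exp ((q + m * (t - t₀)) * (z ^ 2 + 1)) with hφ
  suffices H : ∀ ε : ℝ, 0 < ε → ∀ t ∈ Icc t₀ t₁, ∀ z, u t z - ε * φ t z ≤ 0 by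
    intro t ht z
    by_contra! hpos
    have hφ0 : 0 < φ t z := Real.exp_pos _
    have := H (u t z / (2 * φ t z)) (by positivity) t ht z
    have h2 : u t z / (2 * φ t z) * φ t z = u t z / 2 := by field_simp
    linarith
  intro ε hε t ht z
  by_contra! hpos
  set R : ℝ := A / ε + 1 with hR
  have hR1 : 1 ≤ R := by rw [hR]; linarith [div_nonneg hA hε.le]
  have hout : ∀ s ∈ Icc t₀ t₁, ∀ y, R < |y| → u s y - ε * φ s y < 0 := by
    intro s hs y hy
    have h1 : A / ε < y ^ 2 := by
      rw [← sq_abs]; nlinarith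
    have h2 : A < ε * Real.exp (y ^ 2) := by
      have := Real.add_one_le_exp (y ^ 2)
      rw [div_lt_iff₀ hε] at h1
      nlinarith
    have h3 : Real.exp (a * y ^ 2) * Real.exp (y ^ 2) ≤ φ s y := by
      rw [← Real.exp_add, hφ]
      apply Real.exp_le_exp.2
      have : 0 ≤ m * (s - t₀) := mul_nonneg hm0.le (by linarith [hs.1])
      nlinarith [mul_nonneg this (by positivity : 0 ≤ y ^ 2 + 1)]
    have h4 : A * Real.exp (a * y ^ 2) < ε * Real.exp (y ^ 2) * Real.exp (a * y ^ 2) := by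
      gcongr
    nlinarith [hgrowth s hs y]
  have hφc : Continuous fun p : ℝ × ℝ => φ p.1 p.2 := by rw [hφ]; fun_prop
  have hUc : ContinuousOn (fun p : ℝ × ℝ => u p.1 p.2 - ε * φ p.1 p.2)
      (Icc t₀ t₁ ×ˢ Icc (-R) R) :=
    (hcont.mono (prod_mono_right (subset_univ _))).sub (hφc.const_mul ε).continuousOn
  have hz : z ∈ Icc (-R) R := by
    rw [mem_Icc, ← abs_le]; by_contra! hlt; exact absurd (hout t ht z hlt) (by linarith)
  obtain ⟨⟨s, y⟩, ⟨hs, hy⟩, hmax⟩ :=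
    (isCompact_Icc.prod isCompact_Icc).exists_isMaxOn ⟨(t, z), ht, hz⟩ hUc
  have hUpos : 0 < u s y - ε * φ s y := hpos.trans_le (hmax (a := (t, z)) ⟨ht, hz⟩)
  have hglob : ∀ r ∈ Icc t₀ t₁, ∀ x, u r x - ε * φ r x ≤ u s y - ε * φ s y := by
    intro r hr x
    rcases le_or_gt |x| R with hx | hx
    · exact hmax (a := (r, x)) ⟨hr, abs_le.1 hx⟩
    · linarith [hout r hr x hx]
  simp only at hs
  have hφ0 : 0 < φ s y := Real.exp_pos _
  have hst : t₀ < s := by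
    refine lt_of_le_of_ne hs.1 fun heq => ?_
    have := hinit y
    rw [heq] at this
    nlinarith
  have hs' : s ∈ Ioc t₀ t₁ := ⟨hst, hs.2⟩
  set p := q + m * (s - t₀) with hp
  have hφt : HasDerivAt (fun r => φ r y) (φ s y * (m * (y ^ 2 + 1))) s := by
    have h1 : HasDerivAt (fun r => (q + m * (r - t₀)) * (y ^ 2 + 1)) (m * (y ^ 2 + 1)) s := by
      simpa using ((((hasDerivAt_id s).sub_const t₀).const_mul m).const_add q).mul_const (y ^ 2 + 1)
    exact h1.exp
  have hφz : ∀ x, HasDerivAt (φ s) (φ s x * (2 * p * x)) x := by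
    intro x
    have h1 : HasDerivAt (fun r => p * (r ^ 2 + 1)) (2 * p * x) x := by
      exact (((hasDerivAt_pow 2 x).add_const 1).const_mul p).congr_deriv (by push_cast; ring)
    exact h1.exp
  have hφzz : HasDerivAt (fun x => φ s x * (2 * p * x)) (φ s y * (2 * p + 4 * p ^ 2 * y ^ 2)) y := by
    have h1 : HasDerivAt (fun x => 2 * p * x) (2 * p) y := by
      simpa using (hasDerivAt_id y).const_mul (2 * p)
    exact ((hφz y).mul h1).congr_deriv (by ring)
  have ht' := deriv_nonneg_of_left_max hst ((hut s hs' y).sub (hφt.const_mul ε))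
    fun r hr => hglob r ⟨hr.1, hr.2.trans hs.2⟩ y
  have hD : ∀ x, HasDerivAt (fun x => u s x - ε * φ s x) (uz s x - ε * (φ s x * (2 * p * x))) x :=
    fun x => (huz s hs' x).sub ((hφz x).const_mul ε)
  have hz0 : uz s y - ε * (φ s y * (2 * p * y)) = 0 :=
    IsLocalMax.hasDerivAt_eq_zero (Eventually.of_forall (hglob s hs)) (hD y)
  have hzz := second_deriv_nonpos_of_max hD ((huzz s hs' y).sub (hφzz.const_mul ε)) (hglob s hs)
  have hu0 : 0 < u s y := by nlinarith
  have hmp : 0 ≤ m * (s - t₀) := mul_nonneg hm0.le (by linarith)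
  have hmp2 : m * (s - t₀) ≤ q := le_trans (by gcongr; exact hs.2) hlen
  have hsup := mul_le_mul_of_nonneg_left
    (gaussian_supersolution (c := c) (p := p) (z := y) hq0 hm (by linarith) (by linarith))
    (mul_pos hε hφ0).le
  have hz0c : c * uz s y = c * (ε * (φ s y * (2 * p * y))) := by
    rw [sub_eq_zero.1 hz0]
  linarith [hsub s hs' y hu0]

/-- **Phragmen-Lindelof maximum principle.** The differential inequality is only needed where the
function is positive. -/
theorem nonpos_of_subsolution {u ut uz uzz : ℝ → ℝ → ℝ} {c A a T : ℝ}
    (hcont : ContinuousOn (fun p : ℝ × ℝ => u p.1 p.2) (Icc 0 T ×ˢ univ))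
    (hgrowth : ∀ t ∈ Icc 0 T, ∀ z, u t z ≤ A * Real.exp (a * z ^ 2))
    (hinit : ∀ z, u 0 z ≤ 0)
    (hut : ∀ t ∈ Ioc 0 T, ∀ z, HasDerivAt (fun s => u s z) (ut t z) t)
    (huz : ∀ t ∈ Ioc 0 T, ∀ z, HasDerivAt (u t) (uz t z) z)
    (huzz : ∀ t ∈ Ioc 0 T, ∀ z, HasDerivAt (uz t) (uzz t z) z)
    (hsub : ∀ t ∈ Ioc 0 T, ∀ z, 0 < u t z → ut t z ≤ uzz t z - c * uz t z - u t z) :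
    ∀ t ∈ Icc 0 T, ∀ z, u t z ≤ 0 := by
  set q := |a| + 1 with hq
  set m := 16 * q ^ 2 + 4 * q + 2 * |c| * q with hm
  have hq0 : 0 < q := by positivity
  have hm0 : 0 < m := by positivity
  have hτ : 0 < q / m := by positivity
  have hgrowth' : ∀ t ∈ Icc 0 T, ∀ z, u t z ≤ |A| * Real.exp (|a| * z ^ 2) := by
    intro t ht z
    refine (hgrowth t ht z).trans ?_
    gcongr
    · exact le_abs_self A
    · exact le_abs_self a
  -- The length `q / m` of a step does not depend on the step.
  have key : ∀ n : ℕ, ∀ t ∈ Icc 0 T, t ≤ n * (q / m) → ∀ z, u t z ≤ 0 := by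
    intro n
    induction n with
    | zero =>
      intro t ht htn z
      have : t = 0 := le_antisymm (by simpa using htn) ht.1
      rw [this]; exact hinit z
    | succ n ih =>
      intro t ht htn z
      rcases le_or_gt t (n * (q / m)) with hle | hgt
      · exact ih t ht hle z
      have hn0 : 0 ≤ n * (q / m) := by positivity
      have hI : Icc (n * (q / m)) t ⊆ Icc 0 T := Icc_subset_Icc hn0 ht.2
      have hJ : Ioc (n * (q / m)) t ⊆ Ioc 0 T := Ioc_subset_Ioc hn0 ht.2
      have hlen : m * (t - n * (q / m)) ≤ q := by
        push_cast at htn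
        calc m * (t - n * (q / m)) ≤ m * (q / m) := by gcongr; linarith
          _ = q := by field_simp
      exact nonpos_of_subsolution_short (abs_nonneg a) (abs_nonneg A) hq hm hlen
        (hcont.mono (prod_mono_left hI)) (fun s hs => hgrowth' s (hI hs))
        (ih _ ⟨hn0, hgt.le.trans ht.2⟩ le_rfl) (fun s hs => hut s (hJ hs))
        (fun s hs => huz s (hJ hs)) (fun s hs => huzz s (hJ hs)) (fun s hs => hsub s (hJ hs))
        t ⟨hgt.le, le_rfl⟩ z
  intro t ht z
  obtain ⟨n, hn⟩ := exists_nat_ge (t / (q / m))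
  exact key n t ht ((div_le_iff₀ hτ).1 hn) z

/-! ### Comparison of two solutions with an exponential barrier -/

/-- `K e^{-γt} e^{l (z-b)}`; for `l = 0` it does not depend on `z`. -/
noncomputable def barrier (K γ l b t z : ℝ) : ℝ :=
  K * Real.exp (-γ * t) * Real.exp (l * (z - b))

lemma barrier_nonneg {K γ l b t z : ℝ} (hK : 0 ≤ K) : 0 ≤ barrier K γ l b t z := by
  unfold barrier; positivity

/-- A difference of two solutions stays below an exponential barrier if, wherever it exceeds the
barrier, the delayed source is at most what makes the barrier a supersolution. -/
lemma sub_le_barrier {g : ℝ → ℝ} {h c : ℝ} {v ψ : ℝ → ℝ → ℝ} (hh : 0 ≤ h)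
    (hv : IsSolution g h c v) (hψ : IsSolution g h c ψ) {K γ l b T : ℝ} (hK : 0 ≤ K)
    (hinit : ∀ z, v 0 z - ψ 0 z ≤ barrier K γ l b 0 z)
    (hsource : ∀ t ∈ Ioc 0 T, ∀ z, barrier K γ l b t z < v t z - ψ t z →
      g (v (t - h) (z - c * h)) - g (ψ (t - h) (z - c * h)) ≤
        (-l ^ 2 + c * l + 1 - γ) * barrier K γ l b t z) :
    ∀ t ∈ Icc 0 T, ∀ z, v t z - ψ t z ≤ barrier K γ l b t z := by
  obtain ⟨A, a, hAa⟩ := hv.growth T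
  have hbc : Continuous fun p : ℝ × ℝ => barrier K γ l b p.1 p.2 := by
    unfold barrier; fun_prop
  have hIcc : Icc 0 T ⊆ Ici (-h) := fun t ht => by
    rw [mem_Ici]; linarith [ht.1]
  have hbt : ∀ t z, HasDerivAt (fun s => barrier K γ l b s z) (-γ * barrier K γ l b t z) t := by
    intro t z
    have h1 : HasDerivAt (fun s => -γ * s) (-γ) t := by
      simpa using (hasDerivAt_id t).const_mul (-γ)
    exact ((h1.exp.const_mul K).mul_const (Real.exp (l * (z - b)))).congr_deriv
      (by unfold barrier; ring)
  have hbz : ∀ t z, HasDerivAt (barrier K γ l b t) (l * barrier K γ l b t z) z := by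
    intro t z
    have h1 : HasDerivAt (fun x => l * (x - b)) l z := by
      simpa using ((hasDerivAt_id z).sub_const b).const_mul l
    exact (h1.exp.const_mul (K * Real.exp (-γ * t))).congr_deriv (by unfold barrier; ring)
  have main := nonpos_of_subsolution (c := c) (A := A) (a := a) (T := T)
    (u := fun t z => v t z - ψ t z - barrier K γ l b t z)
    (ut := fun t z => deriv (fun s => v s z) t - deriv (fun s => ψ s z) t
      - -γ * barrier K γ l b t z)
    (uz := fun t z => deriv (v t) z - deriv (ψ t) z - l * barrier K γ l b t z)
    (uzz := fun t z => deriv (deriv (v t)) z - deriv (deriv (ψ t)) z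
      - l * (l * barrier K γ l b t z))
    (((hv.continuousOn.mono (prod_mono_left hIcc)).sub
      (hψ.continuousOn.mono (prod_mono_left hIcc))).sub hbc.continuousOn)
    (fun t ht z => by
      have h1 := hAa t ⟨hIcc ht, ht.2⟩ z
      have h2 := hψ.nonneg t (hIcc ht) z
      have h3 := barrier_nonneg (γ := γ) (l := l) (b := b) (t := t) (z := z) hK
      linarith)
    (fun z => sub_nonpos.2 (hinit z))
    (fun t ht z => ((hv.differentiable_time t ht.1 z).hasDerivAt.sub
      (hψ.differentiable_time t ht.1 z).hasDerivAt).sub (hbt t z))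
    (fun t ht z => ((hv.differentiable_space t ht.1 z).hasDerivAt.sub
      (hψ.differentiable_space t ht.1 z).hasDerivAt).sub (hbz t z))
    (fun t ht z => ((hv.differentiable_space_deriv t ht.1 z).hasDerivAt.sub
      (hψ.differentiable_space_deriv t ht.1 z).hasDerivAt).sub ((hbz t z).const_mul l))
    (fun t ht z hpos => by
      have h1 := hsource t ht z (by simpa using hpos)
      simp only [hv.equation t ht.1 z, hψ.equation t ht.1 z]
      linarith)
  exact fun t ht z => sub_nonpos.1 (main t ht z)

/-! ### The Lipschitz constant and the characteristic function -/

lemma IsBirthFunction.abs_sub_le {g : ℝ → ℝ} {L : NNReal} {κ : ℝ} (hg : IsBirthFunction g L κ)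
    {x y : ℝ} (hx : 0 ≤ x) (hy : 0 ≤ y) : |g x - g y| ≤ L * |x - y| := by
  simpa [Real.dist_eq] using hg.lipschitz.dist_le_mul x hx y hy

lemma IsBirthFunction.one_le {g : ℝ → ℝ} {L : NNReal} {κ : ℝ} (hg : IsBirthFunction g L κ) :
    (1 : ℝ) ≤ L := by
  have h1 := hg.abs_sub_le hg.pos.le le_rfl
  rw [(hg.fixed κ hg.pos.le).2 (Or.inr rfl), (hg.fixed 0 le_rfl).2 (Or.inl rfl), sub_zero,
    abs_of_pos hg.pos] at h1
  exact le_of_mul_le_mul_right (by linarith) hg.pos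

lemma lipConst_nonneg (g : ℝ → ℝ) (I : Set ℝ) : 0 ≤ lipConst g I := by
  apply Real.sSup_nonneg
  rintro r ⟨x, -, y, -, -, rfl⟩
  positivity

lemma IsBirthFunction.abs_sub_le_lipConst {g : ℝ → ℝ} {L : NNReal} {κ : ℝ}
    (hg : IsBirthFunction g L κ) {I : Set ℝ} {x y : ℝ} (hxI : x ∈ I) (hx : 0 ≤ x) (hyI : y ∈ I)
    (hy : 0 ≤ y) : |g x - g y| ≤ lipConst g I * |x - y| := by
  rcases eq_or_ne x y with rfl | hne
  · simp
  have hpos : 0 < |x - y| := abs_pos.2 (sub_ne_zero.2 hne)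
  rw [← div_le_iff₀ hpos]
  refine le_csSup ⟨L, ?_⟩ ⟨x, ⟨hxI, hx⟩, y, ⟨hyI, hy⟩, hne, rfl⟩
  rintro r ⟨x', ⟨-, hx'⟩, y', ⟨-, hy'⟩, hne', rfl⟩
  rw [div_le_iff₀ (abs_pos.2 (sub_ne_zero.2 hne'))]
  exact hg.abs_sub_le hx' hy'

lemma criticalSpeed_nonneg (L h : ℝ) : 0 ≤ criticalSpeed L h :=
  Real.sInf_nonneg fun _ hx => hx.1.le

lemma concaveOn_charFun {L : ℝ} (hL : 0 ≤ L) (h c : ℝ) : ConcaveOn ℝ univ (charFun L h c) := by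
  have h1 : ConvexOn ℝ univ fun l : ℝ => Real.exp (-l * c * h) := by
    have := convexOn_exp.comp_linearMap (LinearMap.mulLeft ℝ (-(c * h)))
    refine this.congr fun l _ => ?_
    simp only [Function.comp, LinearMap.mulLeft_apply]
    congr 1; ring
  have h2 : ConvexOn ℝ univ fun l : ℝ => l ^ 2 := even_two.convexOn_pow
  have h3 : ConcaveOn ℝ univ fun l : ℝ => c * l + 1 :=
    ((LinearMap.mulLeft ℝ c).concaveOn convex_univ).add_const 1
  refine ((h3.sub h2).sub (h1.smul hL)).congr fun l _ => ?_
  simp [charFun]; ring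

/-- The characteristic function is negative at negative arguments, so its roots are nonnegative. -/
lemma nonneg_of_charFun_eq_zero {L h c l : ℝ} (hL : 1 ≤ L) (hh : 0 ≤ h) (hc : 0 ≤ c)
    (hl : charFun L h c l = 0) : 0 ≤ l := by
  by_contra! hneg
  have h1 : 1 ≤ Real.exp (-l * c * h) :=
    Real.one_le_exp (mul_nonneg (mul_nonneg (by linarith) hc) hh)
  have h2 : c * l ≤ 0 := mul_nonpos_of_nonneg_of_nonpos hc hneg.le
  have h3 : 0 < l ^ 2 := sq_pos_of_neg hneg
  unfold charFun at hl
  nlinarith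

/-! ### Propagation of the weighted bound -/

lemma weight_le_one (l b z : ℝ) : weight l b z ≤ 1 := min_le_left _ _

lemma mul_weight_le_barrier {K γ l b t z : ℝ} (hK : 0 ≤ K) :
    K * Real.exp (-γ * t) * weight l b z ≤ barrier K γ l b t z := by
  unfold barrier weight
  gcongr
  exact min_le_right _ _

/-- The bound holds for every admissible rate `γ`. -/
theorem abs_sub_le_of_admissible {g : ℝ → ℝ} {L : NNReal} {κ h c l : ℝ}
    (hg : IsBirthFunction g L κ) (hh : 0 < h) (hl : 0 ≤ l) {v ψ : ℝ → ℝ → ℝ}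
    (hv : IsSolution g h c v) (hψ : IsSolution g h c ψ) {M b l0 l1 γ : ℝ} (hl1 : l0 < l1)
    (hψM : ∀ t, -h ≤ t → ∀ z, b - c * h ≤ z → ψ t z ∈ Icc (M - l0) (M + l0))
    (hinit : ∀ s ∈ Icc (-h) 0, ∀ z, |v s z - ψ s z| < (l1 - l0) * weight l b z)
    (hγ : 0 ≤ γ)
    (hγ1 : γ + L * Real.exp (γ * h) * Real.exp (-l * c * h) ≤ -l ^ 2 + c * l + 1)
    (hγ2 : lipConst g (Icc (M - l1) (M + l1)) ≤ Real.exp (-γ * h) * (1 - γ)) :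
    ∀ t, -h ≤ t → ∀ z, |v t z - ψ t z| ≤ (l1 - l0) * Real.exp (-γ * t) * weight l b z := by
  set K := l1 - l0 with hKdef
  have hK : 0 < K := sub_pos.2 hl1
  set Λ := lipConst g (Icc (M - l1) (M + l1)) with hΛ
  have hΛ0 : 0 ≤ Λ := lipConst_nonneg _ _
  have hstart : ∀ s ∈ Icc (-h) 0, ∀ z,
      |v s z - ψ s z| ≤ K * Real.exp (-γ * s) * weight l b z := by
    intro s hs z
    refine (hinit s hs z).le.trans ?_
    have h1 : 1 ≤ Real.exp (-γ * s) := Real.one_le_exp (by nlinarith [hs.2])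
    have h2 : 0 ≤ weight l b z := le_min zero_le_one (Real.exp_pos _).le
    gcongr
    nlinarith
  have key : ∀ n : ℕ, ∀ t ∈ Icc (-h) (n * h), ∀ z,
      |v t z - ψ t z| ≤ K * Real.exp (-γ * t) * weight l b z := by
    intro n
    induction n with
    | zero => intro t ht; exact hstart t (by simpa using ht)
    | succ n ih =>
      have hdelay : ∀ t ∈ Ioc 0 (((n + 1 : ℕ) : ℝ) * h), t - h ∈ Icc (-h) (n * h) := by
        intro t ht
        have := ht.2
        push_cast at this
        exact ⟨by linarith [ht.1], by linarith⟩
      have hsrc1 : ∀ t ∈ Ioc 0 (((n + 1 : ℕ) : ℝ) * h), ∀ z,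
          |g (v (t - h) (z - c * h)) - g (ψ (t - h) (z - c * h))| ≤
            (-l ^ 2 + c * l + 1 - γ) * barrier K γ l b t z := by
        intro t ht z
        have hd := hdelay t ht
        have hshift : barrier K γ l b (t - h) (z - c * h) =
            Real.exp (γ * h) * Real.exp (-l * c * h) * barrier K γ l b t z := by
          unfold barrier
          rw [show -γ * (t - h) = γ * h + -γ * t by ring,
            show l * (z - c * h - b) = -l * c * h + l * (z - b) by ring, Real.exp_add,
            Real.exp_add]
          ring
        calc _ ≤ L * |v (t - h) (z - c * h) - ψ (t - h) (z - c * h)| :=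
              hg.abs_sub_le (hv.nonneg _ hd.1 _) (hψ.nonneg _ hd.1 _)
          _ ≤ L * barrier K γ l b (t - h) (z - c * h) := by
              gcongr
              exact (ih _ hd _).trans (mul_weight_le_barrier hK.le)
          _ = (L * Real.exp (γ * h) * Real.exp (-l * c * h)) * barrier K γ l b t z := by
              rw [hshift]; ring
          _ ≤ _ := mul_le_mul_of_nonneg_right (by linarith) (barrier_nonneg hK.le)
      have hsrc2 : ∀ t ∈ Ioc 0 (((n + 1 : ℕ) : ℝ) * h), ∀ z, b ≤ z →
          |g (v (t - h) (z - c * h)) - g (ψ (t - h) (z - c * h))| ≤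
            (-0 ^ 2 + c * 0 + 1 - γ) * barrier K γ 0 b t z := by
        intro t ht z hz
        have hd := hdelay t ht
        set x := v (t - h) (z - c * h)
        set y := ψ (t - h) (z - c * h)
        have hy : y ∈ Icc (M - l0) (M + l0) := hψM _ hd.1 _ (by linarith)
        have hw : |x - y| ≤ K * Real.exp (-γ * (t - h)) :=
          (ih _ hd _).trans (mul_le_of_le_one_right (by positivity) (weight_le_one _ _ _))
        -- For `t - h ≤ 0` the exponential factor is at least `1`; the unweighted initial bound
        -- is what keeps `x` in the interval.
        have hxy : |x - y| ≤ K := by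
          rcases le_or_gt (t - h) 0 with h0 | h0
          · exact (hinit _ ⟨hd.1, h0⟩ _).le.trans
              (mul_le_of_le_one_right hK.le (weight_le_one _ _ _))
          · exact hw.trans (mul_le_of_le_one_right hK.le
              (Real.exp_le_one_iff.2 (by nlinarith)))
        have hx : x ∈ Icc (M - l1) (M + l1) := by
          have := abs_le.1 hxy
          exact ⟨by linarith [hy.1], by linarith [hy.2]⟩
        have hexp : Real.exp (-γ * h) * Real.exp (-γ * (t - h)) = Real.exp (-γ * t) := by
          rw [← Real.exp_add]; congr 1; ring
        calc |g x - g y| ≤ Λ * |x - y| :=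
              hg.abs_sub_le_lipConst hx (hv.nonneg _ hd.1 _)
                ⟨by linarith [hy.1], by linarith [hy.2]⟩ (hψ.nonneg _ hd.1 _)
          _ ≤ Real.exp (-γ * h) * (1 - γ) * (K * Real.exp (-γ * (t - h))) :=
              mul_le_mul hγ2 hw (abs_nonneg _) (hΛ0.trans hγ2)
          _ = _ := by
              unfold barrier
              rw [zero_mul, Real.exp_zero, ← hexp]; ring
      -- The one-sided bound, for `v - ψ` and for `ψ - v`.
      have half : ∀ v' ψ' : ℝ → ℝ → ℝ, IsSolution g h c v' → IsSolution g h c ψ' →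
          (∀ t z, |v' t z - ψ' t z| = |v t z - ψ t z|) →
          (∀ t z, |g (v' t z) - g (ψ' t z)| = |g (v t z) - g (ψ t z)|) →
          ∀ t ∈ Icc 0 (((n + 1 : ℕ) : ℝ) * h), ∀ z,
            v' t z - ψ' t z ≤ K * Real.exp (-γ * t) * weight l b z := by
        intro v' ψ' hv' hψ' heq hgeq
        have hinit' : ∀ z, v' 0 z - ψ' 0 z ≤ K * Real.exp (-γ * 0) * weight l b z := fun z =>
          (le_abs_self _).trans ((heq 0 z).le.trans (hstart 0 ⟨by linarith, le_rfl⟩ z))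
        have hb1 := sub_le_barrier hh.le hv' hψ' hK.le
          (fun z => (hinit' z).trans (mul_weight_le_barrier hK.le))
          (fun t ht z _ => (le_abs_self _).trans ((hgeq _ _).le.trans (hsrc1 t ht z)))
        have hb2 := sub_le_barrier (l := 0) (b := b) hh.le hv' hψ' hK.le
          (fun z => (hinit' z).trans (by
            unfold barrier
            rw [zero_mul, Real.exp_zero]
            gcongr
            exact weight_le_one _ _ _))
          (fun t ht z hlt => by
            -- To the left of `b` the barrier with exponent `l` lies below the constant one.
            have hz : b ≤ z := by
              by_contra! hzb
              have h1 := hb1 t ⟨ht.1.le, ht.2⟩ z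
              have h2 : barrier K γ l b t z ≤ barrier K γ 0 b t z := by
                unfold barrier
                gcongr K * Real.exp (-γ * t) * Real.exp ?_
                rw [zero_mul]
                exact mul_nonpos_of_nonneg_of_nonpos hl (by linarith)
              linarith
            exact (le_abs_self _).trans ((hgeq _ _).le.trans (hsrc2 t ht z hz)))
        intro t ht z
        rw [weight, mul_min_of_nonneg _ _ (by positivity)]
        refine le_min ?_ (hb1 t ht z)
        simpa [barrier] using hb2 t ht z
      intro t ht z
      rcases le_or_gt t 0 with h0 | h0
      · exact hstart t ⟨ht.1, h0⟩ z
      rw [abs_sub_le_iff]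
      exact ⟨half v ψ hv hψ (fun _ _ => rfl) (fun _ _ => rfl) t ⟨h0.le, ht.2⟩ z,
        half ψ v hψ hv (fun _ _ => abs_sub_comm _ _) (fun _ _ => abs_sub_comm _ _)
          t ⟨h0.le, ht.2⟩ z⟩
  intro t ht z
  obtain ⟨n, hn⟩ := exists_nat_ge (t / h)
  exact key n t ⟨ht, (div_le_iff₀ hh).1 hn⟩ z

/-! ### The largest admissible rate -/

/-- The set of admissible rates is compact, so it has a largest element once it contains `0`. -/
lemma exists_isGreatest_rate {a B Λ h : ℝ} (ha : 0 ≤ a) (h0 : a ≤ B) (hΛ : Λ ≤ 1) :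
    ∃ γ, IsGreatest {γ : ℝ | 0 ≤ γ ∧ γ + a * Real.exp (γ * h) ≤ B ∧
      Λ ≤ Real.exp (-γ * h) * (1 - γ)} γ := by
  refine IsCompact.exists_isGreatest ?_ ⟨0, by simpa using ⟨h0, hΛ⟩⟩
  refine Metric.isCompact_of_isClosed_isBounded ?_ ?_
  · simp only [ofPred_and]
    refine (isClosed_le ?_ ?_).inter ((isClosed_le ?_ ?_).inter (isClosed_le ?_ ?_)) <;> fun_prop
  · refine (Metric.isBounded_Icc 0 B).subset fun γ hγ => ⟨hγ.1, ?_⟩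
    have := mul_nonneg ha (Real.exp_pos (γ * h)).le
    linarith [hγ.2.1]

end DelayedRD

theorem mainTheorem8
    (g : ℝ → ℝ) (Lg : NNReal) (κ : ℝ) (hg : DelayedRD.IsBirthFunction g Lg κ)
    (h : ℝ) (hh : 0 < h)
    (c : ℝ) (hc : DelayedRD.criticalSpeed Lg h ≤ c)
    (lam1 lam2 lamc : ℝ) (hlam : lam1 ≤ lam2)
    (hroots : {l : ℝ | DelayedRD.charFun Lg h c l = 0} = {lam1, lam2})
    (hlamc : lamc ∈ Set.Icc lam1 lam2)
    (v ψ : ℝ → ℝ → ℝ)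
    (hv : DelayedRD.IsSolution g h c v) (hψ : DelayedRD.IsSolution g h c ψ)
    (M b l0 l1 : ℝ) (hl0 : 0 < l0) (hl1 : l0 < l1)
    (hψM : ∀ t, -h ≤ t → ∀ z, b - c * h ≤ z → ψ t z ∈ Set.Icc (M - l0) (M + l0))
    (hinit : ∀ s ∈ Set.Icc (-h) 0, ∀ z,
      |v s z - ψ s z| < (l1 - l0) * DelayedRD.weight lamc b z)
    (hcontr : DelayedRD.lipConst g (Set.Icc (M - l1) (M + l1)) < 1) :
    ∃ γ₀ : ℝ, 0 ≤ γ₀ ∧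
      γ₀ + Lg * Real.exp (γ₀ * h) * Real.exp (-lamc * c * h) ≤ -lamc ^ 2 + c * lamc + 1 ∧
      DelayedRD.lipConst g (Set.Icc (M - l1) (M + l1)) ≤ Real.exp (-γ₀ * h) * (1 - γ₀) ∧
      ∀ t, -h ≤ t → ∀ z,
        |v t z - ψ t z| ≤ (l1 - l0) * Real.exp (-γ₀ * t) * DelayedRD.weight lamc b z := by
  have hc0 : 0 ≤ c := (DelayedRD.criticalSpeed_nonneg Lg h).trans hc
  have hr1 : DelayedRD.charFun Lg h c lam1 = 0 := hroots.ge (Set.mem_insert lam1 {lam2})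
  have hr2 : DelayedRD.charFun Lg h c lam2 = 0 :=
    hroots.ge (Set.mem_insert_of_mem lam1 (Set.mem_singleton lam2))
  have hl0 : 0 ≤ lamc :=
    (DelayedRD.nonneg_of_charFun_eq_zero hg.one_le hh.le hc0 hr1).trans hlamc.1
  have hE : 0 ≤ DelayedRD.charFun Lg h c lamc := by
    have := (DelayedRD.concaveOn_charFun Lg.2 h c).min_le_of_mem_Icc
      (Set.mem_univ lam1) (Set.mem_univ lam2) hlamc
    simpa [hr1, hr2] using this
  obtain ⟨γ₀, ⟨hγ, hγ1, hγ2⟩, -⟩ := DelayedRD.exists_isGreatest_rate (h := h)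
    (a := Lg * Real.exp (-lamc * c * h)) (B := -lamc ^ 2 + c * lamc + 1)
    (by positivity) (by unfold DelayedRD.charFun at hE; linarith) hcontr.le
  have hγ1' : γ₀ + Lg * Real.exp (γ₀ * h) * Real.exp (-lamc * c * h) ≤
      -lamc ^ 2 + c * lamc + 1 := by
    rw [mul_right_comm]; exact hγ1
  exact ⟨γ₀, hγ, hγ1', hγ2, DelayedRD.abs_sub_le_of_admissible hg hh hl0 hv hψ hl1 hψM hinit
    hγ hγ1' hγ2⟩
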